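/- Let $K=K(p)$ be a positive integer for every prime $p$. All $o(\cdot)$ are as $p\to\infty$ through the primes, and for $A\subset\mathbb F_p$ and integers $a,b$ we write $aA+b=\{ax+b: x\in A\}\subset\mathbb F_p$. Suppose that there are sets $A_p\subset\mathbb F_p$, one for each prime $p$, such that $|A_p|=(1/2+o(1))p$ and $$\max_{\substack{a,b\in\mathbb Z\\ 1\le |a|\le K(p),\ |b|\le K(p)\\ p\nmid a}}\frac{|A_p\,\triangle\,(aA_p+b)|}{p}=o(1).$$ Then $K=o(\log p)$. Conversely, if $K=o(\log p)$, then such sets $A_p$ exist. -/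

import Mathlib

open Filter Topology Asymptotics

/-- The filter `p → ∞` on the primes. -/
def primesAtTop : Filter Nat.Primes :=
  comap (fun p : Nat.Primes => (p : ℕ)) atTop

/-- The image `a • A + b = {a x + b : x ∈ A}` of a set `A` of residues modulo `p` under the
affine map `x ↦ a x + b`, for integers `a` and `b`. -/
def affineImage (p : ℕ) (a b : ℤ) (A : Finset (ZMod p)) : Finset (ZMod p) :=
  A.image fun x => (a : ZMod p) * x + (b : ZMod p)

/-- The finite set of pairs of integers `(a, b)` with `1 ≤ |a| ≤ K`, `|b| ≤ K` and `p ∤ a`. -/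
noncomputable def affineParams (p K : ℕ) : Finset (ℤ × ℤ) :=
  (Finset.Icc (-(K : ℤ)) K ×ˢ Finset.Icc (-(K : ℤ)) K).filter
    fun ab => 1 ≤ |ab.1| ∧ ¬ (p : ℤ) ∣ ab.1

/-- The maximum of `|A △ (a A + b)|` over all integers `a, b` with `1 ≤ |a| ≤ K`, `|b| ≤ K`
and `p ∤ a`. -/
noncomputable def affineDefect (p K : ℕ) (A : Finset (ZMod p)) : ℕ :=
  (affineParams p K).sup fun ab => (symmDiff A (affineImage p ab.1 ab.2 A)).card

/-- The family of sets `A p ⊆ 𝔽_p`, indexed by the primes, has density `1 / 2 + o(1)` and is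
almost invariant, uniformly over the affine maps `x ↦ a x + b` with `1 ≤ |a| ≤ K p`, `|b| ≤ K p`
and `p ∤ a`, as `p → ∞` through the primes. -/
def IsAlmostAffineInvariant (K : Nat.Primes → ℕ) (A : (p : Nat.Primes) → Finset (ZMod p)) :
    Prop :=
  Tendsto (fun p : Nat.Primes => ((A p).card : ℝ) / (p : ℕ)) primesAtTop (𝓝 (1 / 2)) ∧
  Tendsto (fun p : Nat.Primes => (affineDefect p (K p) (A p) : ℝ) / (p : ℕ)) primesAtTop (𝓝 0)

/-! Necessity is Fourier analytic. Let w(k) be the squared modulus of the Fourier transform of the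
balanced indicator of A, of total mass W = p²α(1-α), where α = |A|/p. Almost invariance under
translations by b < K confines most of w to |k| < p/K (`sum_specWeight_tail_le`), and almost
invariance under dilation by a prime q ≤ K/2 makes w almost invariant under k ↦ qk. For |k| < p/K
this multiplication does not wrap around modulo p, so M iterations push most of the mass onto
integers k divisible by q^M (`sum_specWeight_le_dvd`). Weight this by M log q and sum over the
primes q ≤ n, with n about K/2. A nonzero frequency, being at most p in absolute value, has total
weight at most log p, hence M θ(n)(1 - o(1)) ≤ log p (`mul_theta_le_log`). As θ(n) ≫ n and M is
arbitrary, K = o(log p).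

Conversely, let D = lcm(1,…,K)^N and let R be the divisors of D with both signs, so that negative a
are allowed. Each a with 1 ≤ |a| ≤ K divides all but a proportion 2/N of R
(`card_signedDivisors_not_dvd`). The map x ↦ ax + b sends r⁻¹(i + t) to (r/a)⁻¹(i + (r/a)b + t), so
the union over r ∈ R of r⁻¹(t + [0, L)) is almost invariant once L is much larger than DK. There is
room for this because log D = Nψ(K) = o(log p). A greedy union of such blocks with little overlap
reaches density 1/2 and keeps the relative error small (`exists_greedy_union`,
`exists_dilatedInterval_sdiff`). -/

/-! ### Spectrum of the balanced indicator -/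

/-- Parseval's identity for the discrete Fourier transform. -/
lemma sum_norm_sq_dft {n : ℕ} [NeZero n] (f : ZMod n → ℂ) :
    ∑ k, ‖ZMod.dft f k‖ ^ 2 = n * ∑ j, ‖f j‖ ^ 2 := by
  have key : ∑ k, ZMod.dft f k * (starRingEnd ℂ) (ZMod.dft f k)
      = n * ∑ j, f j * (starRingEnd ℂ) (f j) := by
    have h1 : ∀ k, (starRingEnd ℂ) (ZMod.dft f k)
        = ∑ j, ZMod.stdAddChar (j * k) * (starRingEnd ℂ) (f j) := by
      intro k
      simp [ZMod.dft_apply, map_sum, ← AddChar.map_neg_eq_conj]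
    simp_rw [h1, Finset.mul_sum]
    rw [Finset.sum_comm]
    refine Finset.sum_congr rfl fun j _ => ?_
    have h2 : ∑ k, ZMod.stdAddChar (-(k * -j)) • ZMod.dft f k = n * f j := by
      rw [← ZMod.dft_apply, ZMod.dft_dft]; simp
    calc _ = (∑ k, ZMod.stdAddChar (-(k * -j)) • ZMod.dft f k) * (starRingEnd ℂ) (f j) := by
          rw [Finset.sum_mul]
          refine Finset.sum_congr rfl fun k _ => ?_
          rw [smul_eq_mul, show -(k * -j) = j * k by ring]; ring
      _ = _ := by rw [h2]; ring
  simp_rw [Complex.mul_conj'] at key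
  exact_mod_cast key

lemma dft_comp_add {n : ℕ} [NeZero n] (f : ZMod n → ℂ) (b k : ZMod n) :
    ZMod.dft (fun j => f (j + b)) k = ZMod.stdAddChar (b * k) * ZMod.dft f k := by
  simp only [ZMod.dft_apply, smul_eq_mul]
  rw [← Equiv.sum_comp (Equiv.subRight b), Finset.mul_sum]
  refine Finset.sum_congr rfl fun j _ => ?_
  simp only [Equiv.subRight_apply, sub_add_cancel]
  rw [← mul_assoc, ← AddChar.map_add_eq_mul]
  congr 2; ring

/-- The balanced indicator function `1_A - |A| / n`. -/
noncomputable def balanced {n : ℕ} (A : Finset (ZMod n)) (j : ZMod n) : ℂ :=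
  (((if j ∈ A then 1 else 0) - (A.card : ℝ) / n : ℝ) : ℂ)

/-- The energy spectrum of the balanced indicator function of `A`. -/
noncomputable def specWeight {n : ℕ} [NeZero n] (A : Finset (ZMod n)) (k : ZMod n) : ℝ :=
  ‖ZMod.dft (balanced A) k‖ ^ 2

lemma specWeight_nonneg {n : ℕ} [NeZero n] (A : Finset (ZMod n)) (k : ZMod n) :
    0 ≤ specWeight A k := by unfold specWeight; positivity

/-- Balancing is done for this: 0 is divisible by every prime power, so mass there would escape the
divisibility argument. -/
lemma specWeight_zero {n : ℕ} [NeZero n] (A : Finset (ZMod n)) : specWeight A 0 = 0 := by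
  have : (n : ℝ) ≠ 0 := by exact_mod_cast NeZero.ne n
  have h : (∑ j, balanced A j) = 0 := by
    unfold balanced
    rw [← Complex.ofReal_sum, Finset.sum_sub_distrib]
    simp [ZMod.card]
    field_simp
    simp
  simp [specWeight, ZMod.dft_apply_zero, h]

lemma sum_specWeight {n : ℕ} [NeZero n] (A : Finset (ZMod n)) :
    ∑ k, specWeight A k = n ^ 2 * ((A.card : ℝ) / n * (1 - (A.card : ℝ) / n)) := by
  have hn : (n : ℝ) ≠ 0 := by exact_mod_cast NeZero.ne n
  unfold specWeight
  rw [sum_norm_sq_dft]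
  have : ∀ j, ‖balanced A j‖ ^ 2 =
      (if j ∈ A then 1 else 0) * (1 - 2 * ((A.card : ℝ) / n)) + ((A.card : ℝ) / n) ^ 2 := by
    intro j
    unfold balanced
    rw [Complex.norm_real, Real.norm_eq_abs, sq_abs]
    split_ifs <;> ring
  simp_rw [this]
  rw [Finset.sum_add_distrib, ← Finset.sum_mul]
  simp [ZMod.card]
  field_simp
  ring

lemma norm_sq_balanced_sub {n : ℕ} (A : Finset (ZMod n)) (i j : ZMod n) :
    ‖balanced A i - balanced A j‖ ^ 2 = if (i ∈ A ↔ j ∈ A) then 0 else 1 := by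
  unfold balanced
  rw [← Complex.ofReal_sub, Complex.norm_real, Real.norm_eq_abs, sq_abs]
  by_cases hi : i ∈ A <;> by_cases hj : j ∈ A <;> (simp [hi, hj]; try (ring_nf; simp))

/-! ### Affine maps and their action on the spectrum -/

lemma mem_affineImage {p : ℕ} [Fact p.Prime] {a b : ℤ} (ha : (a : ZMod p) ≠ 0)
    (A : Finset (ZMod p)) (x : ZMod p) :
    (a : ZMod p) * x + b ∈ affineImage p a b A ↔ x ∈ A := by
  unfold affineImage
  rw [Finset.mem_image]
  constructor
  · rintro ⟨y, hy, h⟩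
    have := mul_left_cancel₀ ha (add_right_cancel h)
    rwa [← this]
  · intro h; exact ⟨x, h, rfl⟩

/-- The energy of the change of the balanced indicator under an affine map is the size of the
symmetric difference. -/
lemma sum_balanced_affine {p : ℕ} [Fact p.Prime] {a b : ℤ} (ha : (a : ZMod p) ≠ 0)
    (A : Finset (ZMod p)) :
    ∑ j, ‖balanced A ((a : ZMod p) * j + b) - balanced A j‖ ^ 2
      = ((symmDiff A (affineImage p a b A)).card : ℝ) := by
  simp_rw [norm_sq_balanced_sub]
  have e : ∑ j : ZMod p, (if ((a : ZMod p) * j + b ∈ A ↔ j ∈ A) then (0 : ℝ) else 1)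
      = ∑ x : ZMod p, (if (x ∈ A ↔ x ∈ affineImage p a b A) then (0 : ℝ) else 1) := by
    refine Fintype.sum_bijective (fun j => (a : ZMod p) * j + b) ?_ _ _ fun j => ?_
    · exact Finite.injective_iff_bijective.mp fun x y h => mul_left_cancel₀ ha (add_right_cancel h)
    · simp only [mem_affineImage ha]
  rw [e, ← Finset.filter_univ_mem (symmDiff A _), ← Finset.sum_boole]
  refine Finset.sum_congr rfl fun x _ => ?_
  simp only [Finset.mem_symmDiff]
  by_cases h1 : x ∈ A <;> by_cases h2 : x ∈ affineImage p a b A <;> simp [h1, h2]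

lemma card_symmDiff_le_affineDefect {p K : ℕ} {a b : ℤ} (A : Finset (ZMod p))
    (ha : |a| ≤ K) (hb : |b| ≤ K) (ha1 : 1 ≤ |a|) (hpa : ¬ (p : ℤ) ∣ a) :
    (symmDiff A (affineImage p a b A)).card ≤ affineDefect p K A := by
  refine Finset.le_sup (f := fun ab : ℤ × ℤ => (symmDiff A (affineImage p ab.1 ab.2 A)).card)
    (b := (a, b)) ?_
  simp only [affineParams, Finset.mem_filter, Finset.mem_product, Finset.mem_Icc]
  exact ⟨⟨abs_le.mp ha, abs_le.mp hb⟩, ha1, hpa⟩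

/-- Allows K to be lowered to about c log p in the proof that K = o(log p). -/
lemma affineDefect_mono {p : ℕ} (A : Finset (ZMod p)) {K K' : ℕ} (h : K ≤ K') :
    affineDefect p K A ≤ affineDefect p K' A := by
  refine Finset.sup_mono fun ab => ?_
  simp only [affineParams, Finset.mem_filter, Finset.mem_product, Finset.mem_Icc]
  rintro ⟨⟨⟨h1, h2⟩, h3, h4⟩, h5⟩
  exact ⟨⟨⟨by lia, by lia⟩, by lia, by lia⟩, h5⟩

/-- Almost invariance under multiplication makes the spectrum almost invariant. -/
lemma sum_abs_specWeight_sub_le {p : ℕ} [Fact p.Prime] {a : ℤ} (ha : (a : ZMod p) ≠ 0)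
    (A : Finset (ZMod p)) :
    ∑ k, |specWeight A ((a : ZMod p) * k) - specWeight A k|
      ≤ 2 * √(p * (symmDiff A (affineImage p a 0 A)).card) * √(∑ k, specWeight A k) := by
  have hperm : ∀ g : ZMod p → ℝ, ∑ k, g ((a : ZMod p) * k) = ∑ k, g k := fun g =>
    Fintype.sum_bijective (fun k => (a : ZMod p) * k)
      (Finite.injective_iff_bijective.mp fun x y h => mul_left_cancel₀ ha h) _ _ fun _ => rfl
  set F := ZMod.dft (balanced A) with hF
  -- Composing with j ↦ aj moves the coefficient at a⁻¹k to k; reindexing by k ↦ ak removes the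
  -- inverse.
  have hdiff : ∑ k, ‖F k - F ((a : ZMod p) * k)‖ ^ 2
      = p * (symmDiff A (affineImage p a 0 A)).card := by
    rw [← sum_balanced_affine ha, ← sum_norm_sq_dft,
      ← hperm fun k => ‖ZMod.dft _ k‖ ^ 2]
    refine Finset.sum_congr rfl fun k _ => ?_
    have hd : (fun j => balanced A ((a : ZMod p) * j + ((0 : ℤ) : ZMod p)) - balanced A j)
        = (fun j => balanced A ((Units.mk0 _ ha : (ZMod p)ˣ) * j)) - balanced A := by
      ext j; simp
    rw [hd, map_sub, Pi.sub_apply, ZMod.dft_comp_unitMul, ← hF]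
    simp [ha]
  have hpt : ∀ k, |specWeight A ((a : ZMod p) * k) - specWeight A k|
      ≤ ‖F k - F ((a : ZMod p) * k)‖ * (‖F k‖ + ‖F ((a : ZMod p) * k)‖) := by
    intro k
    unfold specWeight
    rw [← hF, sq_sub_sq, abs_mul, mul_comm, add_comm ‖F k‖,
      abs_of_nonneg (add_nonneg (norm_nonneg (F ((a : ZMod p) * k))) (norm_nonneg (F k)))]
    gcongr
    rw [norm_sub_rev]
    exact abs_norm_sub_norm_le _ _
  have h4 : ∑ k, (‖F k‖ + ‖F ((a : ZMod p) * k)‖) ^ 2 ≤ 4 * ∑ k, specWeight A k := by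
    calc _ ≤ ∑ k, (2 * specWeight A k + 2 * specWeight A ((a : ZMod p) * k)) := by
          refine Finset.sum_le_sum fun k _ => ?_
          unfold specWeight
          nlinarith [sq_nonneg (‖F k‖ - ‖F ((a : ZMod p) * k)‖)]
      _ = _ := by
          rw [Finset.sum_add_distrib, ← Finset.mul_sum, ← Finset.mul_sum, hperm (specWeight A)]
          ring
  calc _ ≤ ∑ k, ‖F k - F ((a : ZMod p) * k)‖ * (‖F k‖ + ‖F ((a : ZMod p) * k)‖) :=
        Finset.sum_le_sum fun k _ => hpt k
    _ ≤ √(∑ k, ‖F k - F ((a : ZMod p) * k)‖ ^ 2) *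
        √(∑ k, (‖F k‖ + ‖F ((a : ZMod p) * k)‖) ^ 2) := Real.sum_mul_le_sqrt_mul_sqrt _ _ _
    _ ≤ √(p * (symmDiff A (affineImage p a 0 A)).card) * √(4 * ∑ k, specWeight A k) := by
        rw [hdiff]
        gcongr
    _ = _ := by
        rw [Real.sqrt_mul (by norm_num : (0 : ℝ) ≤ 4), show √(4 : ℝ) = 2 by
          rw [show (4 : ℝ) = 2 ^ 2 by norm_num, Real.sqrt_sq (by norm_num)]]
        ring

/-- A translation by b multiplies the k-th coefficient by the b-th power of the character value at
k; then Parseval applies. -/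
lemma sum_specWeight_translate {p : ℕ} [Fact p.Prime] (A : Finset (ZMod p)) (b : ℕ) :
    ∑ k, ‖(ZMod.stdAddChar k : ℂ) ^ b - 1‖ ^ 2 * specWeight A k
      = p * (symmDiff A (affineImage p 1 b A)).card := by
  have h1 : ((1 : ℤ) : ZMod p) ≠ 0 := by simp
  rw [← sum_balanced_affine (b := (b : ℤ)) h1, ← sum_norm_sq_dft]
  refine Finset.sum_congr rfl fun k _ => ?_
  have : ZMod.dft (fun j => balanced A (((1 : ℤ) : ZMod p) * j + ((b : ℤ) : ZMod p)) - balanced A j) k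
      = ((ZMod.stdAddChar k : ℂ) ^ b - 1) * ZMod.dft (balanced A) k := by
    rw [sub_mul, one_mul, ← AddChar.map_nsmul_eq_pow, nsmul_eq_mul, ← dft_comp_add]
    rw [show (fun j => balanced A (((1 : ℤ) : ZMod p) * j + ((b : ℤ) : ZMod p)) - balanced A j)
      = (fun j => balanced A (j + b)) - balanced A by ext j; simp, map_sub]
    rfl
  rw [this, norm_mul, mul_pow]
  rfl

/-- A geometric sum of a root of unity with phase at least `1 / K` is small, so most of its powers
are far from `1`. -/
lemma le_sum_norm_stdAddChar_pow_sub_one {p : ℕ} [NeZero p] {K : ℕ} {k : ZMod p}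
    (hk : (p : ℤ) ≤ K * |k.valMinAbs|) :
    (K : ℝ) ≤ ∑ b ∈ Finset.range K, ‖(ZMod.stdAddChar k : ℂ) ^ b - 1‖ ^ 2 := by
  rcases Nat.eq_zero_or_pos K with rfl | hK
  · simp
  have hp : (0 : ℝ) < p := by exact_mod_cast NeZero.pos p
  have hK' : (0 : ℝ) < K := by exact_mod_cast hK
  set z : ℂ := ZMod.stdAddChar k with hz
  set v : ℤ := k.valMinAbs with hv
  have hzv : z = Complex.exp (Complex.I * (2 * Real.pi * v / p : ℝ)) := by
    rw [hz, ← ZMod.coe_valMinAbs k, ZMod.stdAddChar_coe]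
    congr 1
    push_cast
    ring
  have hz1 : ‖z‖ = 1 := by rw [hzv, mul_comm]; exact Complex.norm_exp_ofReal_mul_I _
  have hhalf : |(v : ℝ)| ≤ p / 2 := by
    have := ZMod.valMinAbs_mem_Ioc k
    rw [← hv, Set.mem_Ioc] at this
    rw [abs_le]
    have h1 : (-(p : ℝ)) < v * 2 := by exact_mod_cast this.1
    have h2 : (v : ℝ) * 2 ≤ p := by exact_mod_cast this.2
    constructor <;> linarith
  -- Jordan's inequality: |z - 1| = 2|sin(πv/p)| ≥ 4|v|/p.
  have hlow : 4 / K ≤ ‖z - 1‖ := by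
    rw [hzv, Complex.norm_exp_I_mul_ofReal_sub_one, norm_mul, Real.norm_eq_abs, Real.norm_eq_abs,
      abs_two, show 2 * Real.pi * v / p / 2 = Real.pi * (v / p) by ring]
    have hpi := Real.pi_pos
    have h1 : |Real.pi * (v / p)| ≤ Real.pi / 2 := by
      rw [abs_mul, abs_of_pos hpi, abs_div, abs_of_pos hp, div_eq_mul_inv Real.pi]
      gcongr
      rw [div_le_iff₀ hp]; linarith
    have h2 := Real.mul_abs_le_abs_sin h1
    rw [abs_mul, abs_of_pos hpi, abs_div, abs_of_pos hp] at h2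
    have h3 : (p : ℝ) ≤ K * |(v : ℝ)| := by exact_mod_cast hk
    have h4 : 1 / K ≤ |(v : ℝ)| / p := by
      rw [div_le_div_iff₀ hK' hp]; linarith
    have h5 : 2 / Real.pi * (Real.pi * (|(v : ℝ)| / p)) = 2 * (|(v : ℝ)| / p) := by
      field_simp
    rw [h5] at h2
    calc 4 / (K : ℝ) = 2 * (2 * (1 / K)) := by ring
      _ ≤ _ := by linarith
  have hgeom : ‖∑ b ∈ Finset.range K, z ^ b‖ ≤ K / 2 := by
    have h1 : ‖∑ b ∈ Finset.range K, z ^ b‖ * ‖z - 1‖ ≤ 2 := by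
      rw [← norm_mul, geom_sum_mul]
      refine (norm_sub_le _ _).trans ?_
      rw [norm_pow, hz1]; norm_num
    have h2 : ‖∑ b ∈ Finset.range K, z ^ b‖ * (4 / K) ≤ 2 :=
      (mul_le_mul_of_nonneg_left hlow (norm_nonneg _)).trans h1
    rw [← mul_div_assoc, div_le_iff₀ hK'] at h2
    linarith
  -- The sum over b is then 2K minus twice the real part of the geometric sum, hence at least 2K -
  -- K.
  have hexp : ∀ b : ℕ, ‖z ^ b - 1‖ ^ 2 = 2 - 2 * (z ^ b).re := by
    intro b
    have h1 : Complex.normSq (z ^ b) = 1 := by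
      rw [Complex.normSq_eq_norm_sq, norm_pow, hz1]; norm_num
    rw [← Complex.normSq_eq_norm_sq, Complex.normSq_sub, h1]
    simp
    ring
  simp_rw [hexp]
  rw [Finset.sum_sub_distrib, ← Finset.mul_sum, ← Complex.re_sum]
  have := (Complex.re_le_norm (∑ b ∈ Finset.range K, z ^ b)).trans hgeom
  rw [Finset.sum_const, Finset.card_range, nsmul_eq_mul]
  linarith

/-! ### Concentration on small, highly divisible frequencies -/

/-- Almost invariance under small translations confines the spectrum to small frequencies. -/
lemma sum_specWeight_tail_le {p : ℕ} [Fact p.Prime] {K : ℕ} (hK : 1 ≤ K) (A : Finset (ZMod p)) :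
    ∑ k with (p : ℤ) ≤ K * |k.valMinAbs|, specWeight A k ≤ p * affineDefect p K A := by
  have hK' : (0 : ℝ) < K := by exact_mod_cast hK
  -- Average over the translations b < K: each tail frequency gains a factor K on the left, and K
  -- defects bound the right.
  have h1 : K * ∑ k with (p : ℤ) ≤ K * |k.valMinAbs|, specWeight A k
      ≤ ∑ b ∈ Finset.range K, ∑ k, ‖(ZMod.stdAddChar k : ℂ) ^ b - 1‖ ^ 2 * specWeight A k := by
    rw [Finset.sum_comm, Finset.mul_sum]
    simp_rw [← Finset.sum_mul]
    refine (Finset.sum_le_sum fun k hk => ?_).trans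
      (Finset.sum_le_sum_of_subset_of_nonneg (Finset.filter_subset _ _) fun k _ _ => ?_)
    · exact mul_le_mul_of_nonneg_right
        (le_sum_norm_stdAddChar_pow_sub_one (Finset.mem_filter.mp hk).2) (specWeight_nonneg A k)
    · exact mul_nonneg (Finset.sum_nonneg fun _ _ => by positivity) (specWeight_nonneg A k)
  have h2 : ∑ b ∈ Finset.range K, ∑ k, ‖(ZMod.stdAddChar k : ℂ) ^ b - 1‖ ^ 2 * specWeight A k
      ≤ ∑ b ∈ Finset.range K, (p * affineDefect p K A : ℝ) := by
    refine Finset.sum_le_sum fun b hb => ?_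
    rw [sum_specWeight_translate]
    have := Finset.mem_range.mp hb
    have hp1 : ¬ (p : ℤ) ∣ 1 := by
      have := (Fact.out : p.Prime).one_lt
      intro h
      have := Int.le_of_dvd one_pos h
      lia
    gcongr
    exact card_symmDiff_le_affineDefect A (by simpa using hK) (by simpa using this.le)
      (by simp) hp1
  rw [Finset.sum_const, Finset.card_range, nsmul_eq_mul] at h2
  exact le_of_mul_le_mul_left (h1.trans h2) hK'

/-- The spectral mass of a set of frequencies all of whose small elements are mapped to `T` by
multiplication by `a`. -/
lemma sum_specWeight_le_of_mapsTo {p : ℕ} [Fact p.Prime] {a : ℤ} (ha : (a : ZMod p) ≠ 0)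
    {K : ℕ} (hK : 1 ≤ K) (haK : |a| ≤ K) (A S T : Finset (ZMod p))
    (hST : ∀ k ∈ S, (K : ℤ) * |k.valMinAbs| < p → (a : ZMod p) * k ∈ T) :
    ∑ k ∈ S, specWeight A k ≤ ∑ k ∈ T, specWeight A k + p * affineDefect p K A
      + 2 * √(p * affineDefect p K A) * √(∑ k, specWeight A k) := by
  have hpa : ¬ (p : ℤ) ∣ a := by rwa [← ZMod.intCast_zmod_eq_zero_iff_dvd] at *
  have ha1 : 1 ≤ |a| := by
    have : a ≠ 0 := by rintro rfl; simp at ha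
    exact Int.one_le_abs this
  have htail := sum_specWeight_tail_le hK A
  have hD := sum_abs_specWeight_sub_le ha A
  have hdef : ((symmDiff A (affineImage p a 0 A)).card : ℝ) ≤ affineDefect p K A := by
    exact_mod_cast card_symmDiff_le_affineDefect A haK (by simp) ha1 hpa
  have hD' : ∑ k, |specWeight A ((a : ZMod p) * k) - specWeight A k|
      ≤ 2 * √(p * affineDefect p K A) * √(∑ k, specWeight A k) := by
    refine hD.trans ?_
    gcongr
  set S' := S.filter fun k => (K : ℤ) * |k.valMinAbs| < p with hS'
  have h1 : ∑ k ∈ S, specWeight A k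
      ≤ ∑ k ∈ S', specWeight A k + ∑ k with (p : ℤ) ≤ K * |k.valMinAbs|, specWeight A k := by
    rw [← Finset.sum_filter_add_sum_filter_not S (fun k => (K : ℤ) * |k.valMinAbs| < (p : ℤ))]
    refine add_le_add le_rfl ?_
    refine Finset.sum_le_sum_of_subset_of_nonneg (fun k hk => ?_) fun k _ _ => specWeight_nonneg A k
    simpa using (Finset.mem_filter.mp hk).2
  have h2 : ∑ k ∈ S', specWeight A ((a : ZMod p) * k) ≤ ∑ k ∈ T, specWeight A k := by
    rw [← Finset.sum_image (f := specWeight A) (g := fun k => (a : ZMod p) * k)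
      fun x _ y _ h => mul_left_cancel₀ ha h]
    refine Finset.sum_le_sum_of_subset_of_nonneg (fun k hk => ?_) fun k _ _ => specWeight_nonneg A k
    obtain ⟨x, hx, rfl⟩ := Finset.mem_image.mp hk
    exact hST x (Finset.mem_filter.mp hx).1 (Finset.mem_filter.mp hx).2
  have h3 : ∑ k ∈ S', specWeight A k
      ≤ ∑ k ∈ S', specWeight A ((a : ZMod p) * k)
        + ∑ k, |specWeight A ((a : ZMod p) * k) - specWeight A k| := by
    calc _ ≤ ∑ k ∈ S', (specWeight A ((a : ZMod p) * k)
          + |specWeight A ((a : ZMod p) * k) - specWeight A k|) := by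
          refine Finset.sum_le_sum fun k _ => ?_
          have := neg_abs_le (specWeight A ((a : ZMod p) * k) - specWeight A k)
          linarith
      _ ≤ _ := by
          rw [Finset.sum_add_distrib]
          gcongr
          exact Finset.subset_univ _
  linarith

/-- Most of the spectral mass of an almost invariant set is on frequencies divisible by `q ^ M`. -/
lemma sum_specWeight_le_dvd {p : ℕ} [Fact p.Prime] {q K : ℕ} (hqp : (q : ZMod p) ≠ 0)
    (hqK : 2 * q ≤ K) (A : Finset (ZMod p)) (M : ℕ) :
    ∑ k, specWeight A k ≤ ∑ k with (q : ℤ) ^ M ∣ k.valMinAbs, specWeight A k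
      + M * (p * affineDefect p K A
        + 2 * √(p * affineDefect p K A) * √(∑ k, specWeight A k)) := by
  have hq : 1 ≤ q := Nat.one_le_iff_ne_zero.mpr (by rintro rfl; simp at hqp)
  induction M with
  | zero => simp
  | succ M ih =>
    have h := sum_specWeight_le_of_mapsTo (a := q) (by exact_mod_cast hqp) (by lia)
      (by rw [Nat.abs_cast]; lia) A
      (Finset.univ.filter fun k : ZMod p => (q : ℤ) ^ M ∣ k.valMinAbs)
      (Finset.univ.filter fun k : ZMod p => (q : ℤ) ^ (M + 1) ∣ k.valMinAbs) (K := K) ?_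
    · push_cast
      linarith
    · intro k hk hkp
      simp only [Finset.mem_filter, Finset.mem_univ, true_and] at hk ⊢
      -- No wrap-around: 2q ≤ K and K|k| < p give 2q|k| < p, so the least absolute residue of qk is
      -- the integer product.
      have hv : ((q : ℤ) * k : ZMod p).valMinAbs = q * k.valMinAbs := by
        rw [ZMod.valMinAbs_spec]
        refine ⟨by rw [Int.cast_mul, ZMod.coe_valMinAbs, Int.cast_natCast], ?_⟩
        have h2 : 2 * ((q : ℤ) * |k.valMinAbs|) ≤ K * |k.valMinAbs| := by
          rw [← mul_assoc]
          exact mul_le_mul_of_nonneg_right (by exact_mod_cast hqK) (abs_nonneg _)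
        have h3 := abs_lt.mp (show |(q : ℤ) * k.valMinAbs * 2| < p by
          rw [abs_mul, abs_mul, Nat.abs_cast, abs_two]; linarith)
        exact ⟨h3.1, h3.2.le⟩
      rw [hv, pow_succ']
      exact mul_dvd_mul_left _ hk

lemma prod_pow_dvd_of_forall {s : Finset ℕ} (hs : ∀ q ∈ s, q.Prime) {M n : ℕ}
    (h : ∀ q ∈ s, q ^ M ∣ n) : ∏ q ∈ s, q ^ M ∣ n :=
  Finset.prod_dvd_of_isRelPrime (fun _ hq _ hr hne =>
    Nat.coprime_iff_isRelPrime.mp (Nat.coprime_pow_primes _ _ (hs _ hq) (hs _ hr) hne)) h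

/-- The quantitative obstruction to almost invariance. -/
theorem mul_theta_le_log {p : ℕ} [Fact p.Prime] {K n : ℕ} (hK : 2 * n ≤ K) (hn : n < p)
    (A : Finset (ZMod p)) {δ : ℝ} (hδ : (affineDefect p K A : ℝ) ≤ δ * p) (hδ1 : δ ≤ 1)
    (hA : 1 / 9 ≤ (A.card : ℝ) / p * (1 - (A.card : ℝ) / p)) (M : ℕ) :
    M * Chebyshev.theta n * (1 - M * (15 * √δ)) ≤ Real.log p := by
  have hpp : p.Prime := Fact.out
  have hp : (0 : ℝ) < p := by exact_mod_cast hpp.pos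
  have hδ0 : 0 ≤ δ := by
    by_contra! h
    have : (0 : ℝ) ≤ affineDefect p K A := Nat.cast_nonneg _
    nlinarith
  set W := ∑ k, specWeight A k with hW
  have hW1 : (p : ℝ) ^ 2 / 9 ≤ W := by
    rw [hW, sum_specWeight]
    nlinarith [sq_nonneg (p : ℝ)]
  have hW0 : 0 < W := lt_of_lt_of_le (by positivity) hW1
  -- 15 = 9 + 6: the first term is at most δp² ≤ 9√δ W by p² ≤ 9W and δ ≤ √δ, the second at most 2√δ
  -- p√W ≤ 6√δ W by p ≤ 3√W.
  have herr : p * affineDefect p K A + 2 * √(p * affineDefect p K A) * √W ≤ 15 * √δ * W := by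
    have h1 : (p : ℝ) * affineDefect p K A ≤ δ * p ^ 2 := by nlinarith
    have h2 : √((p : ℝ) * affineDefect p K A) ≤ √δ * p := by
      refine (Real.sqrt_le_sqrt h1).trans ?_
      rw [Real.sqrt_mul hδ0, Real.sqrt_sq hp.le]
    have h3 : (p : ℝ) ≤ 3 * √W := by
      have : (p : ℝ) / 3 ≤ √W := Real.le_sqrt_of_sq_le (by nlinarith)
      linarith
    have h4 : δ ≤ √δ := by
      nlinarith [Real.sq_sqrt hδ0, Real.sqrt_nonneg δ, Real.sqrt_le_one.mpr hδ1]
    have h5 : √W * √W = W := Real.mul_self_sqrt hW0.le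
    have h6 : √((p : ℝ) * affineDefect p K A) * √W ≤ √δ * (3 * √W) * √W := by
      have := Real.sqrt_nonneg δ
      gcongr
      exact h2.trans (by gcongr)
    have h7 : δ * (p : ℝ) ^ 2 ≤ √δ * (9 * W) := by
      have := Real.sqrt_nonneg δ
      gcongr
      linarith
    have h8 : √δ * (3 * √W) * √W = 3 * (√δ * W) := by linear_combination 3 * √δ * h5
    linarith
  have hmass : ∀ q ∈ Nat.primesLE n,
      W * (1 - M * (15 * √δ)) ≤ ∑ k with (q : ℤ) ^ M ∣ k.valMinAbs, specWeight A k := by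
    intro q hq
    have hq' := Nat.mem_primesLE.mp hq
    have hqp : (q : ZMod p) ≠ 0 := by
      rw [Ne, ZMod.natCast_eq_zero_iff]
      exact Nat.not_dvd_of_pos_of_lt hq'.2.pos (by lia)
    have h1 := sum_specWeight_le_dvd hqp (by lia : 2 * q ≤ K) A M
    have h2 := mul_le_mul_of_nonneg_left herr (Nat.cast_nonneg (α := ℝ) M)
    linarith
  -- The coprime powers q^M dividing k have a product dividing |k|, which is less than p when k ≠ 0;
  -- at k = 0 the weight vanishes.
  have hpt : ∀ k : ZMod p, specWeight A k *
      ∑ q ∈ Nat.primesLE n, (if (q : ℤ) ^ M ∣ k.valMinAbs then M * Real.log q else 0)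
        ≤ specWeight A k * Real.log p := by
    intro k
    rcases eq_or_ne k 0 with rfl | hk
    · simp [specWeight_zero]
    refine mul_le_mul_of_nonneg_left ?_ (specWeight_nonneg A k)
    have hk0 : k.valMinAbs.natAbs ≠ 0 := by simpa using hk
    rw [← Finset.sum_filter]
    set s := (Nat.primesLE n).filter fun q : ℕ => (q : ℤ) ^ M ∣ k.valMinAbs
    have hs : ∀ q ∈ s, q.Prime := fun q hq =>
      (Nat.mem_primesLE.mp (Finset.mem_filter.mp hq).1).2
    have hdvd := prod_pow_dvd_of_forall hs (M := M) (n := k.valMinAbs.natAbs) fun q hq => by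
      have := (Finset.mem_filter.mp hq).2
      rw [← Int.natCast_dvd_natCast, Int.dvd_natAbs]
      exact_mod_cast this
    have hle : ∏ q ∈ s, q ^ M ≤ p :=
      (Nat.le_of_dvd (Nat.pos_of_ne_zero hk0) hdvd).trans
        ((ZMod.natAbs_valMinAbs_le k).trans (Nat.div_le_self _ _))
    calc ∑ q ∈ s, M * Real.log q = Real.log ((∏ q ∈ s, q ^ M : ℕ) : ℝ) := by
          push_cast
          rw [Real.log_prod fun q hq => by have := (hs q hq).ne_zero; positivity]
          simp
      _ ≤ Real.log p := by
          refine Real.log_le_log ?_ (by exact_mod_cast hle)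
          exact_mod_cast Finset.prod_pos fun q hq => pow_pos (hs q hq).pos M
  have hsum : W * (M * Chebyshev.theta n * (1 - M * (15 * √δ))) ≤ W * Real.log p := by
    calc W * (M * Chebyshev.theta n * (1 - M * (15 * √δ)))
        = ∑ q ∈ Nat.primesLE n, M * Real.log q * (W * (1 - M * (15 * √δ))) := by
          rw [Chebyshev.theta_eq_sum_primesLE_log, ← Finset.sum_mul, ← Finset.mul_sum]; ring
      _ ≤ ∑ q ∈ Nat.primesLE n, M * Real.log q *
            ∑ k with (q : ℤ) ^ M ∣ k.valMinAbs, specWeight A k := by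
          refine Finset.sum_le_sum fun q hq => mul_le_mul_of_nonneg_left (hmass q hq) ?_
          have := Real.log_natCast_nonneg q
          positivity
      _ = ∑ k, specWeight A k *
            ∑ q ∈ Nat.primesLE n, (if (q : ℤ) ^ M ∣ k.valMinAbs then M * Real.log q else 0) := by
          simp_rw [Finset.mul_sum, Finset.sum_filter]
          rw [Finset.sum_comm]
          refine Finset.sum_congr rfl fun k _ => Finset.sum_congr rfl fun q _ => ?_
          split_ifs <;> ring
      _ ≤ ∑ k, specWeight A k * Real.log p := Finset.sum_le_sum fun k _ => hpt k
      _ = W * Real.log p := by rw [← Finset.sum_mul]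
  exact le_of_mul_le_mul_left hsum hW0

/-! ### Necessity of K = o(log p) -/

/-- A weak form of Chebyshev's lower bound. -/
lemma eventually_le_theta : ∀ᶠ n : ℕ in atTop, (n : ℝ) / 8 ≤ Chebyshev.theta n := by
  have h1 : (fun x : ℝ => Real.log x) =o[atTop] fun x => x ^ (1 / 4 : ℝ) :=
    isLittleO_log_rpow_atTop (by norm_num)
  have h2 : Tendsto (fun n : ℕ => (n : ℝ)) atTop atTop := tendsto_natCast_atTop_atTop
  have hb := (h1.comp_tendsto h2).bound (show (0 : ℝ) < 1 / 32 by norm_num)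
  filter_upwards [hb, eventually_ge_atTop 16] with n hn hn16
  have hge := Chebyshev.theta_ge n
  have hn0 : (16 : ℝ) ≤ n := by exact_mod_cast hn16
  simp only [Function.comp_apply, Real.norm_eq_abs] at hn
  rw [abs_of_nonneg (Real.log_natCast_nonneg n), abs_of_nonneg (by positivity)] at hn
  -- In terms of x = n^(1/4), where log n ≤ x/32, the error terms become polynomial.
  set x : ℝ := (n : ℝ) ^ (1 / 4 : ℝ) with hx
  have hx0 : 0 < x := by positivity
  have hx4 : x ^ 4 = n := by
    rw [hx, ← Real.rpow_natCast, ← Real.rpow_mul (by linarith)]; norm_num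
  have hsq : √(n : ℝ) = x ^ 2 := by
    rw [← hx4, show x ^ 4 = (x ^ 2) ^ 2 by ring, Real.sqrt_sq (by positivity)]
  have hx2 : 2 ≤ x := by
    by_contra! h
    have : x ^ 4 < 2 ^ 4 := pow_lt_pow_left₀ h hx0.le (by norm_num)
    linarith
  have hlog1 : Real.log (n + 1) ≤ Real.log n + 1 := by
    calc Real.log (n + 1) ≤ Real.log (n * 2) := Real.log_le_log (by linarith) (by linarith)
      _ = Real.log n + Real.log 2 := Real.log_mul (by linarith) (by norm_num)
      _ ≤ _ := by linarith [Real.log_two_lt_d9]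
  have hl2 := Real.log_two_gt_d9
  rw [hsq] at hge
  have h3 : 2 * x ^ 2 * Real.log n ≤ 2 * x ^ 2 * (1 / 32 * x) := by gcongr
  have h4 : x ^ 3 ≤ n / 2 := by
    rw [← hx4]; nlinarith [pow_pos hx0 3]
  have h5 : x ≤ n / 8 := by
    rw [← hx4]
    have : 4 ≤ x ^ 2 := by nlinarith
    nlinarith [mul_le_mul this hx2 (by norm_num) (by positivity), pow_pos hx0 3]
  nlinarith

lemma tendsto_coe_primesAtTop :
    Tendsto (fun p : Nat.Primes => ((p : ℕ) : ℝ)) primesAtTop atTop :=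
  tendsto_natCast_atTop_atTop.comp tendsto_comap

/-- If almost invariant sets exist then `K = o(log p)`. -/
theorem isLittleO_of_isAlmostAffineInvariant {K : Nat.Primes → ℕ}
    {A : (p : Nat.Primes) → Finset (ZMod p)} (h : IsAlmostAffineInvariant K A) :
    (fun p : Nat.Primes => (K p : ℝ)) =o[primesAtTop] fun p : Nat.Primes => Real.log (p : ℕ) := by
  rw [isLittleO_iff]
  intro c hc
  -- If K > c log p, the main inequality will give M c log p / 64 ≤ log p, which is false for M c >
  -- 128.
  obtain ⟨M, hM⟩ := exists_nat_gt (128 / c)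
  have hM0 : (0 : ℝ) < M := lt_trans (by positivity) hM
  have hlog : Tendsto (fun p : Nat.Primes => Real.log (p : ℕ)) primesAtTop atTop :=
    Real.tendsto_log_atTop.comp tendsto_coe_primesAtTop
  obtain ⟨n₀, hn₀⟩ := eventually_atTop.mp eventually_le_theta
  obtain ⟨δ, hδ0, hδ1, hδ⟩ : ∃ δ : ℝ, 0 < δ ∧ δ ≤ 1 ∧ M * (15 * √δ) ≤ 1 / 2 := by
    refine ⟨(min 1 (1 / (30 * M : ℝ))) ^ 2, by positivity, ?_, ?_⟩
    · exact pow_le_one₀ (by positivity) (min_le_left _ _)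
    · rw [Real.sqrt_sq (by positivity)]
      calc M * (15 * min 1 (1 / (30 * M : ℝ))) ≤ M * (15 * (1 / (30 * M))) := by
            gcongr; exact min_le_right _ _
        _ = 1 / 2 := by field_simp; norm_num
  have hsmall : ∀ᶠ p : Nat.Primes in primesAtTop, c * Real.log (p : ℕ) + 1 < (p : ℕ) := by
    have := (Real.isLittleO_log_id_atTop.comp_tendsto tendsto_coe_primesAtTop).bound
      (show 0 < 1 / (2 * c) by positivity)
    filter_upwards [this, tendsto_coe_primesAtTop.eventually_gt_atTop 2] with p hp hp2
    simp only [Function.comp_apply, Real.norm_eq_abs, id] at hp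
    rw [abs_of_nonneg (Real.log_natCast_nonneg _), abs_of_nonneg (by positivity),
      div_mul_eq_mul_div, one_mul, le_div_iff₀ (by positivity)] at hp
    linarith
  have hdens : ∀ᶠ p : Nat.Primes in primesAtTop,
      1 / 9 ≤ ((A p).card : ℝ) / (p : ℕ) * (1 - ((A p).card : ℝ) / (p : ℕ)) := by
    have := h.1.mul (h.1.const_sub 1)
    exact this.eventually_const_le (by norm_num)
  filter_upwards [hsmall, hdens, h.2.eventually_le_const hδ0, hlog.eventually_ge_atTop 1,
    hlog.eventually_ge_atTop ((4 * n₀ + 4) / c)] with p hp1 hp2 hp3 hp4 hp5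
  have : Fact (p : ℕ).Prime := ⟨p.2⟩
  have hpos : (0 : ℝ) < (p : ℕ) := by exact_mod_cast p.2.pos
  rw [Real.norm_eq_abs, Real.norm_eq_abs, abs_of_nonneg (Nat.cast_nonneg _),
    abs_of_nonneg (by linarith)]
  by_contra! hcon
  set L := c * Real.log (p : ℕ) with hL
  have hL0 : 0 ≤ L := by positivity
  -- K may be as large as p or more; this truncation has size exactly of order log p and ensures n <
  -- p.
  set K' := ⌊L⌋₊ with hK'
  have hK'K : K' ≤ K p := by
    have : (K' : ℝ) ≤ L := Nat.floor_le hL0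
    exact_mod_cast this.trans hcon.le
  have hfl : L < K' + 1 := Nat.lt_floor_add_one L
  have hK'L : (K' : ℝ) ≤ L := Nat.floor_le hL0
  have hL4 : 4 * n₀ + 4 ≤ L := by
    rw [div_le_iff₀ hc] at hp5; linarith
  set n := K' / 2 with hn
  have hn4 : L / 4 ≤ n := by
    have : K' < 2 * n + 2 := by lia
    have : (K' : ℝ) + 1 ≤ 2 * n + 2 := by exact_mod_cast this
    have : (0 : ℝ) ≤ n₀ := Nat.cast_nonneg _
    linarith
  have hnn : n₀ ≤ n := by
    have : (n₀ : ℝ) ≤ n := by linarith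
    exact_mod_cast this
  have hnp : n < (p : ℕ) := by
    have h1 : K' < (p : ℕ) := by
      have : (K' : ℝ) < (p : ℕ) := by linarith
      exact_mod_cast this
    lia
  have hdef : (affineDefect p K' (A p) : ℝ) ≤ δ * (p : ℕ) := by
    rw [div_le_iff₀ hpos] at hp3
    refine le_trans ?_ hp3
    exact_mod_cast affineDefect_mono (A p) hK'K
  have hmain := mul_theta_le_log (by lia : 2 * n ≤ K') hnp (A p) hdef hδ1 hp2 M
  have hth := hn₀ n hnn
  have h1 : M * (L / 32) * (1 / 2) ≤ Real.log (p : ℕ) := by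
    refine le_trans ?_ hmain
    have := Chebyshev.theta_nonneg n
    gcongr
    · linarith
    · linarith
  rw [hL] at h1
  rw [div_lt_iff₀ hc] at hM
  nlinarith

/-! ### Divisors of lcm(1, …, K)^N -/

/-- Write D = q^v D' with q ∤ D'. The divisors counted divide q^(e-1) D', which has e τ(D')
divisors, against (v + 1) τ(D') for D. -/
lemma card_divisors_not_pow_dvd {q D : ℕ} (hq : q.Prime) (hD : D ≠ 0) (e : ℕ) :
    {d ∈ D.divisors | ¬ q ^ e ∣ d}.card * (D.factorization q + 1) ≤ e * D.divisors.card := by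
  rcases Nat.eq_zero_or_pos e with rfl | he
  · simp
  set v := D.factorization q
  set D' := ordCompl[q] D
  have hcop : ∀ j, (q ^ j).Coprime D' := fun j =>
    Nat.Coprime.pow_left _ (Nat.coprime_ordCompl hq hD)
  have hcard : ∀ j, (q ^ j * D').divisors.card = (j + 1) * D'.divisors.card := fun j => by
    rw [(hcop j).card_divisors_mul, Nat.divisors_prime_pow hq]; simp
  have hD1 : D.divisors.card = (v + 1) * D'.divisors.card := by
    rw [← hcard, Nat.ordProj_mul_ordCompl_eq_self]
  have hsub : {d ∈ D.divisors | ¬ q ^ e ∣ d} ⊆ (q ^ (e - 1) * D').divisors := by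
    intro d hd
    obtain ⟨hdD, hed⟩ := Finset.mem_filter.mp hd
    have hdD' := Nat.dvd_of_mem_divisors hdD
    have hd0 : d ≠ 0 := fun h => hD (by simpa [h] using hdD')
    rw [hq.pow_dvd_iff_le_factorization hd0] at hed
    rw [Nat.mem_divisors]
    refine ⟨?_, mul_ne_zero (pow_ne_zero _ hq.ne_zero) (Nat.ordCompl_pos q hD).ne'⟩
    rw [← Nat.ordProj_mul_ordCompl_eq_self d q]
    exact mul_dvd_mul (pow_dvd_pow _ (by lia)) (Nat.ordCompl_dvd_ordCompl_of_dvd hdD' q)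
  have := Finset.card_le_card hsub
  rw [hcard, Nat.sub_add_cancel he] at this
  rw [hD1]
  calc _ ≤ (e * D'.divisors.card) * (v + 1) := Nat.mul_le_mul_right _ this
    _ = _ := by ring

/-- All but a proportion `2 / N` of the divisors of `lcm(1, …, K) ^ N` are multiples of a given
`a ≤ K`. -/
lemma card_divisors_not_dvd {a K N : ℕ} (ha : 1 ≤ a) (haK : a ≤ K) :
    N * {d ∈ (Nat.lcmUpto K ^ N).divisors | ¬ a ∣ d}.card
      ≤ 2 * (Nat.lcmUpto K ^ N).divisors.card := by
  set D := Nat.lcmUpto K ^ N with hDdef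
  have hD : D ≠ 0 := pow_ne_zero _ (Nat.lcmUpto_ne_zero K)
  rcases Nat.eq_or_lt_of_le ha with rfl | ha2
  · simp
  have ha0 : a ≠ 0 := by lia
  have hsub : {d ∈ D.divisors | ¬ a ∣ d} ⊆
      a.primeFactors.biUnion fun q => {d ∈ D.divisors | ¬ q ^ a.factorization q ∣ d} := by
    intro d hd
    obtain ⟨hdD, had⟩ := Finset.mem_filter.mp hd
    have hd0 : d ≠ 0 := (Nat.pos_of_mem_divisors hdD).ne'
    rw [← Nat.factorization_le_iff_dvd ha0 hd0, Finsupp.le_def] at had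
    push Not at had
    obtain ⟨q, hq⟩ := had
    have hqa : q ∈ a.primeFactors := by
      rw [← Nat.support_factorization, Finsupp.mem_support_iff]; lia
    refine Finset.mem_biUnion.mpr ⟨q, hqa, Finset.mem_filter.mpr ⟨hdD, ?_⟩⟩
    rw [(Nat.prime_of_mem_primeFactors hqa).pow_dvd_iff_le_factorization hd0]
    lia
  have hlogK : 0 < Real.log K := Real.log_pos (by exact_mod_cast (by lia : 1 < K))
  -- For q^e exactly dividing a, the exceptional proportion is at most e/(Nf) with f = ⌊log_q K⌋.
  -- Since K < q^(f+1) ≤ q^(2f), this is at most 2e log q / (N log K), and the sum over q is 2 log a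
  -- / (N log K) ≤ 2/N.
  have hone : ∀ q ∈ a.primeFactors,
      (N : ℝ) * {d ∈ D.divisors | ¬ q ^ a.factorization q ∣ d}.card * Real.log K
        ≤ 2 * (a.factorization q * Real.log q) * D.divisors.card := by
    intro q hqa
    have hq := Nat.prime_of_mem_primeFactors hqa
    have hqK : q ≤ K := (Nat.le_of_mem_primeFactors hqa).trans haK
    have h1 := card_divisors_not_pow_dvd hq hD (a.factorization q)
    have hfac : D.factorization q = N * Nat.log q K := by
      rw [hDdef, Nat.factorization_pow, Finsupp.smul_apply, Nat.factorization_lcmUpto K hq,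
        smul_eq_mul]
    rw [hfac] at h1
    set f := Nat.log q K
    have hf : 1 ≤ f := Nat.log_pos hq.one_lt hqK
    have hKq : Real.log K ≤ 2 * f * Real.log q := by
      have h2 : K < q ^ (f + 1) := Nat.lt_pow_succ_log_self hq.one_lt K
      calc Real.log K ≤ Real.log ((q : ℝ) ^ (f + 1)) :=
            Real.log_le_log (by exact_mod_cast (by lia : 0 < K)) (by exact_mod_cast h2.le)
        _ = (f + 1) * Real.log q := by rw [Real.log_pow]; push_cast; ring
        _ ≤ _ := by
          have : (1 : ℝ) ≤ f := by exact_mod_cast hf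
          exact mul_le_mul_of_nonneg_right (by linarith) (Real.log_natCast_nonneg q)
    have h3 : ({d ∈ D.divisors | ¬ q ^ a.factorization q ∣ d}.card : ℝ) * (N * f)
        ≤ a.factorization q * D.divisors.card := by
      exact_mod_cast (Nat.mul_le_mul_left _ (Nat.le_succ _)).trans h1
    calc _ ≤ (N : ℝ) * {d ∈ D.divisors | ¬ q ^ a.factorization q ∣ d}.card
          * (2 * f * Real.log q) := by gcongr
      _ = 2 * Real.log q * ({d ∈ D.divisors | ¬ q ^ a.factorization q ∣ d}.card * (N * f)) := by
          ring
      _ ≤ 2 * Real.log q * (a.factorization q * D.divisors.card) := by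
          have := Real.log_natCast_nonneg q
          gcongr
      _ = _ := by ring
  have hsum : ∑ q ∈ a.primeFactors, (a.factorization q * Real.log q) ≤ Real.log K := by
    calc _ = Real.log a := by
          conv_rhs => rw [← Nat.prod_factorization_pow_eq_self ha0]
          rw [Finsupp.prod, Nat.support_factorization]
          push_cast
          rw [Real.log_prod fun q hq => by
            have := (Nat.prime_of_mem_primeFactors hq).ne_zero; positivity]
          simp
      _ ≤ _ := Real.log_le_log (by exact_mod_cast (by lia : 0 < a)) (by exact_mod_cast haK)
  have hcard : ({d ∈ D.divisors | ¬ a ∣ d}.card : ℝ)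
      ≤ ∑ q ∈ a.primeFactors, ({d ∈ D.divisors | ¬ q ^ a.factorization q ∣ d}.card : ℝ) := by
    exact_mod_cast (Finset.card_le_card hsub).trans Finset.card_biUnion_le
  have : ((N : ℝ) * {d ∈ D.divisors | ¬ a ∣ d}.card) * Real.log K
      ≤ (2 * D.divisors.card) * Real.log K := by
    calc _ ≤ (N : ℝ) * (∑ q ∈ a.primeFactors,
            ({d ∈ D.divisors | ¬ q ^ a.factorization q ∣ d}.card : ℝ)) * Real.log K := by gcongr
      _ = ∑ q ∈ a.primeFactors,
          (N : ℝ) * {d ∈ D.divisors | ¬ q ^ a.factorization q ∣ d}.card * Real.log K := by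
          rw [Finset.mul_sum, Finset.sum_mul]
      _ ≤ ∑ q ∈ a.primeFactors, 2 * (a.factorization q * Real.log q) * D.divisors.card :=
          Finset.sum_le_sum hone
      _ = 2 * (∑ q ∈ a.primeFactors, (a.factorization q * Real.log q)) * D.divisors.card := by
          rw [← Finset.sum_mul, Finset.mul_sum]
      _ ≤ 2 * Real.log K * D.divisors.card := by gcongr
      _ = _ := by ring
  exact_mod_cast le_of_mul_le_mul_right this hlogK

/-- The divisors of `D`, of both signs. -/
def signedDivisors (D : ℕ) : Finset ℤ :=
  D.divisors.image (fun d : ℕ => (d : ℤ)) ∪ D.divisors.image (fun d : ℕ => -(d : ℤ))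

lemma mem_signedDivisors {D : ℕ} (hD : D ≠ 0) {r : ℤ} : r ∈ signedDivisors D ↔ r ∣ D := by
  simp only [signedDivisors, Finset.mem_union, Finset.mem_image, Nat.mem_divisors]
  constructor
  · rintro (⟨d, ⟨hd, -⟩, rfl⟩ | ⟨d, ⟨hd, -⟩, rfl⟩)
    · exact_mod_cast hd
    · rw [neg_dvd]; exact_mod_cast hd
  · intro h
    have h' : r.natAbs ∣ D := by rwa [← Int.natCast_dvd_natCast, Int.natAbs_dvd]
    rcases Int.natAbs_eq r with hr | hr
    · exact Or.inl ⟨_, ⟨h', hD⟩, hr.symm⟩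
    · exact Or.inr ⟨_, ⟨h', hD⟩, hr.symm⟩

lemma card_filter_signedDivisors (D : ℕ) (P : ℤ → Prop) [DecidablePred P]
    (hP : ∀ r, P (-r) ↔ P r) :
    {r ∈ signedDivisors D | P r}.card = 2 * {d ∈ D.divisors | P (d : ℕ)}.card := by
  unfold signedDivisors
  rw [Finset.filter_union, Finset.card_union_of_disjoint, Finset.filter_image, Finset.filter_image,
    Finset.card_image_of_injective _ Nat.cast_injective, Finset.card_image_of_injective]
  · simp only [hP]; ring
  · intro x y h; simpa using h
  · refine Finset.disjoint_filter_filter ?_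
    rw [Finset.disjoint_left]
    intro r h1 h2
    obtain ⟨d, hd, rfl⟩ := Finset.mem_image.mp h1
    obtain ⟨d', hd', h⟩ := Finset.mem_image.mp h2
    have := Nat.pos_of_mem_divisors hd
    have := Nat.pos_of_mem_divisors hd'
    lia

lemma card_signedDivisors (D : ℕ) : (signedDivisors D).card = 2 * D.divisors.card := by
  simpa using card_filter_signedDivisors D (fun _ => True) (by simp)

lemma card_signedDivisors_not_dvd {a : ℤ} {K N : ℕ} (ha : 1 ≤ |a|) (haK : |a| ≤ K) :
    N * {r ∈ signedDivisors (Nat.lcmUpto K ^ N) | ¬ a ∣ r}.card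
      ≤ 2 * (signedDivisors (Nat.lcmUpto K ^ N)).card := by
  rw [card_filter_signedDivisors _ _ (by simp), card_signedDivisors]
  have h := card_divisors_not_dvd (a := a.natAbs) (K := K) (N := N) (by rw [Int.abs_eq_natAbs] at ha; lia)
    (by rw [Int.abs_eq_natAbs] at haK; lia)
  simp only [Int.dvd_natCast] at h ⊢
  lia

/-! ### Greedy covering by dilated intervals -/

/-- On each nonempty fibre of size n, n ≤ 1 + n(n - 1). -/
lemma card_le_card_image_add_collisions {α β : Type*} [DecidableEq α] [DecidableEq β]
    (S : Finset α) (f : α → β) :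
    S.card ≤ (S.image f).card + {x ∈ S.offDiag | f x.1 = f x.2}.card := by
  have hcol : {x ∈ S.offDiag | f x.1 = f x.2}.card
      = ∑ y ∈ S.image f, ({x ∈ S | f x = y}.offDiag).card := by
    rw [Finset.card_eq_sum_card_fiberwise (f := fun x => f x.1) (t := S.image f)]
    · refine Finset.sum_congr rfl fun y _ => ?_
      congr 1
      ext ⟨u, v⟩
      simp only [Finset.mem_filter, Finset.mem_offDiag]
      constructor
      · rintro ⟨⟨⟨h1, h2, h3⟩, h4⟩, h5⟩
        exact ⟨⟨h1, h5⟩, ⟨h2, h4 ▸ h5⟩, h3⟩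
      · rintro ⟨⟨h1, h5⟩, ⟨h2, h4⟩, h3⟩
        exact ⟨⟨⟨h1, h2, h3⟩, h5.trans h4.symm⟩, h5⟩
    · intro x hx
      have := Finset.mem_offDiag.mp (Finset.mem_filter.mp hx).1
      exact Finset.mem_image_of_mem f this.1
  rw [hcol, Finset.card_eq_sum_card_image f S, Finset.card_eq_sum_ones (S.image f),
    ← Finset.sum_add_distrib]
  refine Finset.sum_le_sum fun y _ => ?_
  rw [Finset.offDiag_card]
  set n := {x ∈ S | f x = y}.card
  rcases Nat.lt_or_ge n 2 with h | h
  · lia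
  · have : 2 * n ≤ n * n := Nat.mul_le_mul_right n h
    lia

/-- A greedy union of sets of size at most `s`, each of which can be chosen to be mostly new until
half of the space is covered. -/
lemma exists_greedy_union {α ι : Type*} [Fintype α] [DecidableEq α] [DecidableEq ι]
    (F : ι → Finset α) {s : ℕ} (hs : 0 < s) (hF : ∀ t, (F t).card ≤ s)
    (hnew : ∀ A : Finset α, 2 * A.card ≤ Fintype.card α → ∃ t, s ≤ 4 * (F t \ A).card) :
    ∃ J : Finset ι, Fintype.card α ≤ 2 * (J.biUnion F).card ∧
      2 * (J.biUnion F).card ≤ Fintype.card α + 2 * s ∧ J.card * s ≤ 4 * (J.biUnion F).card := by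
  set n := Fintype.card α
  -- Each step adds at least s/4 > 0 new points, so size k is reached unless half is covered first;
  -- k = n + 1 rules out the former.
  have key : ∀ k : ℕ, ∃ J : Finset ι, (n ≤ 2 * (J.biUnion F).card ∨ k ≤ (J.biUnion F).card) ∧
      2 * (J.biUnion F).card ≤ n + 2 * s ∧ J.card * s ≤ 4 * (J.biUnion F).card := by
    intro k
    induction k with
    | zero => exact ⟨∅, by simp⟩
    | succ k ih =>
      obtain ⟨J, h1, h2, h3⟩ := ih
      by_cases hn : n ≤ 2 * (J.biUnion F).card
      · exact ⟨J, Or.inl hn, h2, h3⟩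
      obtain ⟨t, ht⟩ := hnew (J.biUnion F) (by lia)
      have hcard : ((insert t J).biUnion F).card = (F t \ J.biUnion F).card + (J.biUnion F).card := by
        rw [Finset.biUnion_insert, Finset.card_sdiff_add_card]
      have hle : (F t \ J.biUnion F).card ≤ s := (Finset.card_le_card Finset.sdiff_subset).trans (hF t)
      have hJ : (insert t J).card * s ≤ (J.card + 1) * s :=
        Nat.mul_le_mul_right _ (Finset.card_insert_le _ _)
      refine ⟨insert t J, Or.inr ?_, ?_, ?_⟩
      · lia
      · lia
      · rw [hcard]; lia
  obtain ⟨J, h1, h2, h3⟩ := key (n + 1)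
  have := Finset.card_le_univ (J.biUnion F)
  exact ⟨J, by lia, h2, h3⟩

/-- The union over `r ∈ R` of the dilates by `r⁻¹` of the interval `{t, …, t + L - 1}`. -/
def dilatedInterval {p : ℕ} (R : Finset ℤ) (L : ℕ) (t : ZMod p) : Finset (ZMod p) :=
  (R ×ˢ Finset.range L).image fun x => (x.1 : ZMod p)⁻¹ * ((x.2 : ZMod p) + t)

lemma card_dilatedInterval_le {p : ℕ} (R : Finset ℤ) (L : ℕ) (t : ZMod p) :
    (dilatedInterval R L t).card ≤ R.card * L := by
  refine Finset.card_image_le.trans ?_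
  rw [Finset.card_product, Finset.card_range]

/-- First moment in a random t. Each pair (r, i) lands at a uniform point, so on average at least
half of the |R|L pairs miss A. Two distinct pairs collide for at most one t, so on average there are
at most (|R|L)²/p ≤ |R|L/4 collisions. Some t leaves |R|L/4 new points. -/
lemma exists_dilatedInterval_sdiff {p : ℕ} [Fact p.Prime] {R : Finset ℤ} {L : ℕ}
    (hR0 : ∀ r ∈ R, (r : ZMod p) ≠ 0) (hR : Set.InjOn (fun r : ℤ => (r : ZMod p)) R) (hL : L ≤ p)
    (hs : 4 * (R.card * L) ≤ p) (A : Finset (ZMod p)) (hA : 2 * A.card ≤ Fintype.card (ZMod p)) :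
    ∃ t, R.card * L ≤ 4 * (dilatedInterval R L t \ A).card := by
  rw [ZMod.card] at hA
  have hp : 0 < p := (Fact.out : p.Prime).pos
  set S := R ×ˢ Finset.range L with hS
  have hSc : S.card = R.card * L := by rw [hS, Finset.card_product, Finset.card_range]
  rw [← hSc] at hs ⊢
  let f : ZMod p → ℤ × ℕ → ZMod p := fun t x => (x.1 : ZMod p)⁻¹ * ((x.2 : ZMod p) + t)
  have hfa : ∀ t x, f t x = (x.1 : ZMod p)⁻¹ * ((x.2 : ZMod p) + t) := fun _ _ => rfl
  by_contra! hcon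
  have hpt : ∀ t, {x ∈ S | f t x ∉ A}.card ≤ (dilatedInterval R L t \ A).card
      + {x ∈ S.offDiag | f t x.1 = f t x.2}.card := by
    intro t
    refine (card_le_card_image_add_collisions _ (f t)).trans ?_
    refine add_le_add (Finset.card_le_card ?_) (Finset.card_le_card ?_)
    · intro y hy
      obtain ⟨x, hx, rfl⟩ := Finset.mem_image.mp hy
      obtain ⟨hxS, hxA⟩ := Finset.mem_filter.mp hx
      exact Finset.mem_sdiff.mpr ⟨Finset.mem_image_of_mem _ hxS, hxA⟩
    · exact Finset.filter_subset_filter _ (Finset.offDiag_mono (Finset.filter_subset _ _))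
  have hbij : ∀ x ∈ S, Function.Bijective fun t => f t x := by
    intro x hx
    refine Finite.injective_iff_bijective.mp fun t u h => ?_
    exact add_left_cancel (mul_left_cancel₀
      (inv_ne_zero (hR0 x.1 (Finset.mem_product.mp hx).1)) h)
  have hsum1 : ∑ t, {x ∈ S | f t x ∉ A}.card = S.card * (p - A.card) := by
    simp_rw [Finset.card_filter]
    rw [Finset.sum_comm, ← smul_eq_mul, ← Finset.sum_const]
    refine Finset.sum_congr rfl fun x hx => ?_
    rw [Fintype.sum_bijective _ (hbij x hx) _ (fun y => if y ∉ A then 1 else 0) fun _ => rfl,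
      ← Finset.card_filter, Finset.filter_notMem_eq_sdiff, ← Finset.compl_eq_univ_sdiff,
      Finset.card_compl, ZMod.card]
  have hsum2 : ∑ t, {x ∈ S.offDiag | f t x.1 = f t x.2}.card ≤ S.card * S.card := by
    simp_rw [Finset.card_filter]
    rw [Finset.sum_comm]
    calc _ ≤ ∑ x ∈ S.offDiag, 1 := by
          refine Finset.sum_le_sum fun x hx => ?_
          rw [← Finset.card_filter, Finset.card_le_one]
          obtain ⟨h1, h2, hne⟩ := Finset.mem_offDiag.mp hx
          obtain ⟨⟨r, i⟩, ⟨r', i'⟩⟩ := x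
          have hr := hR0 r (Finset.mem_product.mp h1).1
          have hr' := hR0 r' (Finset.mem_product.mp h2).1
          -- A collision is a linear equation in t; it is degenerate only for r = r', and then it
          -- forces i = i' because L ≤ p.
          have hiff : ∀ t, f t (r, i) = f t (r', i') →
              ((r' : ZMod p) - r) * t = r * i' - r' * i := by
            intro t h
            simp only [hfa] at h
            field_simp at h
            linear_combination h
          intro t ht u hu
          replace ht := hiff t (Finset.mem_filter.mp ht).2
          replace hu := (Finset.mem_filter.mp hu).2
          have hu' := hiff u hu
          by_cases hrr : (r' : ZMod p) - r = 0
          · exfalso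
            have hrr' : r = r' := hR (Finset.mem_product.mp h1).1 (Finset.mem_product.mp h2).1
              (sub_eq_zero.mp hrr).symm
            subst hrr'
            apply hne
            have : (i : ZMod p) = i' :=
              add_right_cancel (mul_left_cancel₀ (inv_ne_zero hr) hu)
            have hi := Finset.mem_range.mp (Finset.mem_product.mp h1).2
            have hi' := Finset.mem_range.mp (Finset.mem_product.mp h2).2
            rw [ZMod.natCast_eq_natCast_iff'] at this
            dsimp only at hi hi'
            rw [Nat.mod_eq_of_lt (by lia), Nat.mod_eq_of_lt (by lia)] at this
            rw [this]
          · exact mul_left_cancel₀ hrr (ht.trans hu'.symm)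
      _ ≤ S.card * S.card := by
          rw [← Finset.card_eq_sum_ones, Finset.offDiag_card]
          exact Nat.sub_le _ _
  have hsum3 : ∑ t : ZMod p, 4 * (dilatedInterval R L t \ A).card < p * S.card := by
    calc _ < ∑ t : ZMod p, S.card := Finset.sum_lt_sum_of_nonempty Finset.univ_nonempty
          fun t _ => hcon t
      _ = p * S.card := by simp [ZMod.card]
  have hsum := Finset.sum_le_sum fun t (_ : t ∈ Finset.univ) => hpt t
  rw [hsum1, Finset.sum_add_distrib] at hsum
  rw [← Finset.mul_sum] at hsum3
  have h1 : S.card * p ≤ 2 * (S.card * (p - A.card)) := by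
    rw [mul_left_comm]; exact Nat.mul_le_mul_left _ (by lia)
  have h2 : 4 * (S.card * S.card) ≤ S.card * p := by
    rw [mul_left_comm]; exact Nat.mul_le_mul_left _ hs
  rw [mul_comm p] at hsum3
  lia

/-! ### Almost invariance of the union -/

lemma card_range_shift_le (L : ℕ) (c : ℤ) :
    ((Finset.range L).filter fun i : ℕ => ¬ (0 ≤ (i : ℤ) + c ∧ (i : ℤ) + c < L)).card ≤ c.natAbs := by
  rcases le_total 0 c with h | h
  · calc _ ≤ (Finset.Ico (L - c.natAbs) L).card := by
          refine Finset.card_le_card fun i hi => ?_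
          simp only [Finset.mem_filter, Finset.mem_range, Finset.mem_Ico] at hi ⊢
          lia
      _ ≤ _ := by rw [Nat.card_Ico]; lia
  · calc _ ≤ (Finset.range c.natAbs).card := by
          refine Finset.card_le_card fun i hi => ?_
          simp only [Finset.mem_filter, Finset.mem_range] at hi ⊢
          lia
      _ ≤ _ := by simp

/-- A union of dilated intervals over a set `R` of dilations that is almost closed under division
by `a` is almost invariant under `x ↦ a x + b`. -/
lemma card_symmDiff_dilatedInterval_le {p : ℕ} [Fact p.Prime] {R : Finset ℤ} {L B : ℕ} {a b : ℤ}
    (ha : (a : ZMod p) ≠ 0) (hR0 : ∀ r ∈ R, (r : ZMod p) ≠ 0)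
    (hRa : ∀ r ∈ R, a ∣ r → r / a ∈ R)
    (hB : ∀ r ∈ R, (r * b).natAbs ≤ B) (J : Finset (ZMod p)) :
    (symmDiff (J.biUnion (dilatedInterval R L))
      (affineImage p a b (J.biUnion (dilatedInterval R L)))).card
      ≤ 2 * (J.card * ({r ∈ R | ¬ a ∣ r}.card * L + R.card * B)) := by
  set A := J.biUnion (dilatedInterval R L) with hA
  set A' := affineImage p a b A with hA'
  have hcard : A'.card = A.card :=
    Finset.card_image_of_injective _ fun x y h => mul_left_cancel₀ ha (add_right_cancel h)
  have hsd : (symmDiff A A').card = 2 * (A' \ A).card := by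
    rw [symmDiff_def, Finset.sup_eq_union, Finset.card_union_of_disjoint disjoint_sdiff_sdiff,
      Finset.card_sdiff_comm hcard.symm]
    ring
  rw [hsd]
  refine Nat.mul_le_mul_left _ ?_
  -- The bad pairs: either a ∤ r, or the shift by (r/a)b leaves [0, L). Any other pair is sent into
  -- the block with the same t.
  let T : Finset (ℤ × ℕ) := {x ∈ R ×ˢ Finset.range L | ¬ (a ∣ x.1 ∧
    (0 ≤ (x.2 : ℤ) + x.1 / a * b ∧ (x.2 : ℤ) + x.1 / a * b < L))}
  have hsub : A' \ A ⊆ (J ×ˢ T).image fun y =>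
      (a : ZMod p) * ((y.2.1 : ZMod p)⁻¹ * ((y.2.2 : ZMod p) + y.1)) + b := by
    intro z hz
    obtain ⟨hz', hzA⟩ := Finset.mem_sdiff.mp hz
    obtain ⟨x, hx, rfl⟩ := Finset.mem_image.mp hz'
    obtain ⟨t, ht, hx⟩ := Finset.mem_biUnion.mp hx
    obtain ⟨⟨r, i⟩, hri, rfl⟩ := Finset.mem_image.mp hx
    refine Finset.mem_image.mpr ⟨(t, (r, i)), Finset.mem_product.mpr ⟨ht,
      Finset.mem_filter.mpr ⟨hri, ?_⟩⟩, rfl⟩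
    rintro ⟨⟨r', rfl⟩, h0, h1⟩
    apply hzA
    have ha0 : a ≠ 0 := by rintro rfl; simp at ha
    dsimp only at h0 h1
    have hr' := hRa _ (Finset.mem_product.mp hri).1 (dvd_mul_right a r')
    rw [Int.mul_ediv_cancel_left _ ha0] at h0 h1 hr'
    refine Finset.mem_biUnion.mpr ⟨t, ht, Finset.mem_image.mpr
      ⟨(r', ((i : ℤ) + r' * b).toNat), Finset.mem_product.mpr ⟨hr', Finset.mem_range.mpr (by lia)⟩, ?_⟩⟩
    have hcast : ((((i : ℤ) + r' * b).toNat : ℕ) : ZMod p) = i + r' * b := by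
      have : ((((i : ℤ) + r' * b).toNat : ℤ) : ZMod p) = (((i : ℤ) + r' * b : ℤ) : ZMod p) := by
        rw [Int.toNat_of_nonneg h0]
      push_cast at this
      exact_mod_cast this
    dsimp only
    rw [hcast]
    have hr0 := hR0 r' hr'
    push_cast
    field_simp
    ring
  have hT : T.card ≤ {r ∈ R | ¬ a ∣ r}.card * L + R.card * B := by
    have hT' : T ⊆ ({r ∈ R | ¬ a ∣ r} ×ˢ Finset.range L) ∪
        ({r ∈ R | a ∣ r}.biUnion fun r => ((Finset.range L).filter fun i : ℕ =>
          ¬ (0 ≤ (i : ℤ) + r / a * b ∧ (i : ℤ) + r / a * b < L)).image fun i => (r, i)) := by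
      rintro ⟨r, i⟩ hx
      obtain ⟨h1, h2⟩ := Finset.mem_filter.mp hx
      obtain ⟨hr, hi⟩ := Finset.mem_product.mp h1
      by_cases har : a ∣ r
      · refine Finset.mem_union_right _ (Finset.mem_biUnion.mpr ⟨r, Finset.mem_filter.mpr ⟨hr, har⟩,
          Finset.mem_image.mpr ⟨i, Finset.mem_filter.mpr ⟨hi, fun h => h2 ⟨har, h⟩⟩, rfl⟩⟩)
      · exact Finset.mem_union_left _ (Finset.mem_product.mpr ⟨Finset.mem_filter.mpr ⟨hr, har⟩, hi⟩)
    refine (Finset.card_le_card hT').trans ((Finset.card_union_le _ _).trans (add_le_add ?_ ?_))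
    · rw [Finset.card_product, Finset.card_range]
    · refine (Finset.card_biUnion_le_card_mul _ _ B fun r hr => ?_).trans
        (Nat.mul_le_mul_right _ (Finset.card_le_card (Finset.filter_subset _ _)))
      obtain ⟨hr, har⟩ := Finset.mem_filter.mp hr
      exact Finset.card_image_le.trans ((card_range_shift_le L _).trans (hB _ (hRa r hr har)))
  calc _ ≤ (J ×ˢ T).card := (Finset.card_le_card hsub).trans Finset.card_image_le
    _ = J.card * T.card := Finset.card_product _ _
    _ ≤ _ := Nat.mul_le_mul_left _ hT

/-- Quantitative existence of almost invariant sets of density about `1 / 2`. -/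
theorem exists_almost_invariant {p : ℕ} [Fact p.Prime] {K N L : ℕ} (hL0 : 0 < L) (hL : L ≤ p)
    (hD : 2 * Nat.lcmUpto K ^ N < p) (hs : 8 * (Nat.lcmUpto K ^ N * L) ≤ p) :
    ∃ A : Finset (ZMod p), p ≤ 2 * A.card ∧ 2 * A.card ≤ p + 4 * (Nat.lcmUpto K ^ N * L) ∧
      affineDefect p K A * (N * L) ≤ 8 * p * (2 * L + N * (Nat.lcmUpto K ^ N * K)) := by
  set D := Nat.lcmUpto K ^ N with hDdef
  have hD0 : D ≠ 0 := pow_ne_zero _ (Nat.lcmUpto_ne_zero K)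
  set R := signedDivisors D with hRdef
  have hle : ∀ r ∈ R, r.natAbs ≤ D := fun r hr => by
    rw [mem_signedDivisors hD0, ← Int.natAbs_dvd, Int.natCast_dvd_natCast] at hr
    exact Nat.le_of_dvd (Nat.pos_of_ne_zero hD0) hr
  have hne : ∀ r ∈ R, r ≠ 0 := by
    rintro r hr rfl
    rw [mem_signedDivisors hD0, zero_dvd_iff] at hr
    exact hD0 (by exact_mod_cast hr)
  have hR0 : ∀ r ∈ R, (r : ZMod p) ≠ 0 := by
    intro r hr h
    rw [ZMod.intCast_zmod_eq_zero_iff_dvd] at h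
    have h1 := hle r hr
    exact hne r hr (Int.eq_zero_of_abs_lt_dvd h (by rw [Int.abs_eq_natAbs]; lia))
  have hinj : Set.InjOn (fun r : ℤ => (r : ZMod p)) R := by
    intro r hr r' hr' h
    rw [← sub_eq_zero, ← Int.cast_sub, ZMod.intCast_zmod_eq_zero_iff_dvd] at h
    have h1 := hle r hr
    have h2 := hle r' hr'
    exact sub_eq_zero.mp (Int.eq_zero_of_abs_lt_dvd h (by rw [abs_lt]; lia))
  have hRcard : R.card ≤ 2 * D := by
    rw [hRdef, card_signedDivisors]
    exact Nat.mul_le_mul_left _ (Nat.card_divisors_le_self D)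
  have hRpos : 0 < R.card := Finset.card_pos.mpr ⟨1, (mem_signedDivisors hD0).mpr (one_dvd _)⟩
  have hRL : R.card * L ≤ 2 * (D * L) := by
    rw [← mul_assoc]; exact Nat.mul_le_mul_right _ hRcard
  obtain ⟨J, hJ1, hJ2, hJ3⟩ := exists_greedy_union (dilatedInterval (p := p) R L)
    (Nat.mul_pos hRpos hL0) (card_dilatedInterval_le R L)
    (exists_dilatedInterval_sdiff hR0 hinj hL (by lia))
  rw [ZMod.card] at hJ1 hJ2
  set A := J.biUnion (dilatedInterval (p := p) R L) with hA
  refine ⟨A, hJ1, by lia, ?_⟩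
  have hAp : A.card ≤ p := by simpa [ZMod.card] using Finset.card_le_univ A
  have hNL : ∀ ab ∈ affineParams p K, (symmDiff A (affineImage p ab.1 ab.2 A)).card * (N * L)
      ≤ 8 * p * (2 * L + N * (D * K)) := by
    rintro ⟨a, b⟩ hab
    simp only [affineParams, Finset.mem_filter, Finset.mem_product, Finset.mem_Icc] at hab
    obtain ⟨⟨ha, hb⟩, ha1, hpa⟩ := hab
    have ha0 : (a : ZMod p) ≠ 0 := by rwa [Ne, ZMod.intCast_zmod_eq_zero_iff_dvd]
    have hRa : ∀ r ∈ R, a ∣ r → r / a ∈ R := by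
      intro r hr har
      rw [mem_signedDivisors hD0] at hr ⊢
      exact (Int.ediv_dvd_of_dvd har).trans hr
    have hB : ∀ r ∈ R, (r * b).natAbs ≤ D * K := by
      intro r hr
      rw [Int.natAbs_mul]
      exact Nat.mul_le_mul (hle r hr) (by lia)
    have h1 := card_symmDiff_dilatedInterval_le (L := L) ha0 hR0 hRa hB J
    have h2 := card_signedDivisors_not_dvd (N := N) ha1 (abs_le.mpr ha)
    rw [← hDdef, ← hRdef] at h2
    -- The greedy bound |J||R|L ≤ 4|A| ≤ 4p cancels the size of R, leaving relative errors of order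
    -- 1/N and DK/L.
    calc _ ≤ 2 * (J.card * ({r ∈ R | ¬ a ∣ r}.card * L + R.card * (D * K))) * (N * L) :=
          Nat.mul_le_mul_right _ h1
      _ = 2 * J.card * L * ((N * {r ∈ R | ¬ a ∣ r}.card) * L + N * R.card * (D * K)) := by ring
      _ ≤ 2 * J.card * L * ((2 * R.card) * L + N * R.card * (D * K)) := by gcongr
      _ = 2 * (J.card * (R.card * L)) * (2 * L + N * (D * K)) := by ring
      _ ≤ 2 * (4 * p) * (2 * L + N * (D * K)) := 
          Nat.mul_le_mul_right _ (Nat.mul_le_mul_left _ (by lia))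
      _ = _ := by ring
  rcases (affineParams p K).eq_empty_or_nonempty with h | h
  · simp [affineDefect, h]
  · obtain ⟨ab, hab, heq⟩ := Finset.exists_mem_eq_sup _ h
      fun ab : ℤ × ℤ => (symmDiff A (affineImage p ab.1 ab.2 A)).card
    rw [affineDefect, heq]
    exact hNL ab hab

/-! ### Choice of parameters and conclusion -/

/-- How far a set is from having density `1 / 2` and from being almost invariant. -/
noncomputable def invarianceError (p K : ℕ) (A : Finset (ZMod p)) : ℝ :=
  max |(A.card : ℝ) / p - 1 / 2| ((affineDefect p K A : ℝ) / p)

/-- With X = p^(1/8), take L = ⌊X⁴⌋ and N > 32/ε. For large p both D and K are at most X, so DK/L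
and DL/p are O(X⁻²) and O(X⁻³). -/
lemma eventually_exists_invarianceError_le {K : Nat.Primes → ℕ}
    (hK : (fun p : Nat.Primes => (K p : ℝ)) =o[primesAtTop] fun p : Nat.Primes => Real.log (p : ℕ))
    {ε : ℝ} (hε : 0 < ε) :
    ∀ᶠ p : Nat.Primes in primesAtTop, ∃ A : Finset (ZMod p), invarianceError p (K p) A ≤ ε := by
  obtain ⟨N, hN⟩ := exists_nat_gt (32 / ε)
  have hN0 : (0 : ℝ) < N := lt_trans (by positivity) hN
  have hX : Tendsto (fun p : Nat.Primes => ((p : ℕ) : ℝ) ^ (1 / 8 : ℝ)) primesAtTop atTop :=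
    (tendsto_rpow_atTop (by norm_num)).comp tendsto_coe_primesAtTop
  -- The 8 turns log p into log X; log 4 + 4 is the constant in ψ(K) ≤ (log 4 + 4)K, so that D ≤ X,
  -- and the extra 1 gives K ≤ X.
  have hc : (0 : ℝ) < 1 / (8 * (N * (Real.log 4 + 4) + 1)) := by
    have := Real.log_nonneg (show (1 : ℝ) ≤ 4 by norm_num)
    positivity
  filter_upwards [hK.bound hc, hX.eventually_ge_atTop 4, hX.eventually_ge_atTop (32 / ε)]
    with p hp hX4 hXε
  have : Fact (p : ℕ).Prime := ⟨p.2⟩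
  have hp0 : (0 : ℝ) < (p : ℕ) := by exact_mod_cast p.2.pos
  set X : ℝ := ((p : ℕ) : ℝ) ^ (1 / 8 : ℝ) with hXdef
  have hX0 : 0 < X := by linarith
  have hX8 : X ^ 8 = (p : ℕ) := by
    rw [hXdef, ← Real.rpow_natCast, ← Real.rpow_mul hp0.le]; norm_num
  have hlogX : Real.log (p : ℕ) = 8 * Real.log X := by
    rw [← hX8, Real.log_pow]; norm_num
  rw [Real.norm_eq_abs, Real.norm_eq_abs, abs_of_nonneg (Nat.cast_nonneg _),
    abs_of_nonneg (Real.log_natCast_nonneg _), hlogX, div_mul_eq_mul_div, one_mul,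
    le_div_iff₀ (by have := Real.log_nonneg (show (1 : ℝ) ≤ 4 by norm_num); positivity)] at hp
  have hKN : K p * (N * (Real.log 4 + 4) + 1) ≤ Real.log X := by linarith
  have hK0 : (0 : ℝ) ≤ K p := Nat.cast_nonneg _
  have hpsi0 : 0 ≤ N * ((Real.log 4 + 4) * K p) := by
    have := Real.log_nonneg (show (1 : ℝ) ≤ 4 by norm_num)
    positivity
  have hKX : (K p : ℝ) ≤ X := by
    have h1 : (K p : ℝ) ≤ Real.log X := by linarith
    have := Real.log_le_sub_one_of_pos hX0
    linarith
  set D := Nat.lcmUpto (K p) ^ N with hD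
  have hDX : (D : ℝ) ≤ X := by
    have hl0 : (0 : ℝ) < Nat.lcmUpto (K p) := by exact_mod_cast Nat.lcmUpto_pos _
    rw [← Real.log_le_log_iff (by rw [hD]; push_cast; positivity) hX0, hD]
    push_cast
    rw [Real.log_pow, ← Chebyshev.psi_eq_log_lcmUpto]
    calc N * Chebyshev.psi (K p) ≤ N * ((Real.log 4 + 4) * K p) := by
          gcongr; exact Chebyshev.psi_le_const_mul_self hK0
      _ ≤ Real.log X := by linarith
  set L := ⌊X ^ 4⌋₊ with hLdef
  have hX4' : (256 : ℝ) ≤ X ^ 4 := by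
    calc (256 : ℝ) = 4 ^ 4 := by norm_num
      _ ≤ _ := by gcongr
  have hLle : (L : ℝ) ≤ X ^ 4 := Nat.floor_le (by positivity)
  have hLge : X ^ 4 / 2 ≤ L := by
    have := Nat.lt_floor_add_one (X ^ 4)
    linarith
  have hL0 : 0 < L := by
    have : (0 : ℝ) < L := lt_of_lt_of_le (by positivity) hLge
    exact_mod_cast this
  have hX1 : (1 : ℝ) ≤ X := by linarith
  have hLp : L ≤ (p : ℕ) := by
    have : (L : ℝ) ≤ (p : ℕ) := by
      rw [← hX8]; exact hLle.trans (pow_le_pow_right₀ hX1 (by norm_num))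
    exact_mod_cast this
  have hX3 : (64 : ℝ) ≤ X ^ 3 := by
    calc (64 : ℝ) = 4 ^ 3 := by norm_num
      _ ≤ _ := by gcongr
  have hDL : (D : ℝ) * L ≤ X ^ 5 := by
    calc (D : ℝ) * L ≤ X * X ^ 4 := by gcongr
      _ = X ^ 5 := by ring
  have hDp : 2 * D < (p : ℕ) := by
    have : (2 * D : ℝ) < (p : ℕ) := by
      rw [← hX8]
      calc (2 * D : ℝ) < 64 * X := by linarith
        _ ≤ X ^ 3 * X := by gcongr
        _ = X ^ 4 := by ring
        _ ≤ X ^ 8 := pow_le_pow_right₀ hX1 (by norm_num)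
    exact_mod_cast this
  have hDLp : 8 * (D * L) ≤ (p : ℕ) := by
    have : (8 * (D * L) : ℝ) ≤ (p : ℕ) := by
      rw [← hX8]
      calc (8 * (D * L) : ℝ) ≤ 64 * X ^ 5 := by
            have : 0 ≤ X ^ 5 := by positivity
            linarith
        _ ≤ X ^ 3 * X ^ 5 := by gcongr
        _ = X ^ 8 := by ring
    exact_mod_cast this
  obtain ⟨A, h1, h2, h3⟩ := exists_almost_invariant (K := K p) hL0 hLp hDp hDLp
  have hX2 : 32 / ε ≤ X ^ 2 := hXε.trans (by nlinarith)
  refine ⟨A, max_le ?_ ?_⟩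
  · have h1' : ((p : ℕ) : ℝ) ≤ 2 * A.card := by exact_mod_cast h1
    have h2' : (2 * A.card : ℝ) ≤ (p : ℕ) + 4 * (D * L) := by exact_mod_cast h2
    have h4 : 32 * X ^ 5 ≤ ε * (p : ℕ) := by
      rw [div_le_iff₀ hε] at hX2
      rw [← hX8]
      have : X ^ 6 * 32 ≤ X ^ 6 * (X ^ 2 * ε) := by gcongr
      have h6 : X ^ 5 ≤ X ^ 6 := pow_le_pow_right₀ hX1 (by norm_num)
      calc _ ≤ X ^ 6 * 32 := by linarith
        _ ≤ _ := this
        _ = _ := by ring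
    have h5 : 0 < X ^ 5 := by positivity
    rw [abs_le]
    constructor
    · rw [neg_le_sub_iff_le_add, ← sub_le_iff_le_add, le_div_iff₀ hp0]
      nlinarith
    · rw [sub_le_iff_le_add, div_le_iff₀ hp0]
      nlinarith
  · have hL' : (0 : ℝ) < L := by exact_mod_cast hL0
    have h3' : (affineDefect p (K p) A : ℝ) * (N * L)
        ≤ 8 * (p : ℕ) * (2 * L + N * (D * K p)) := by exact_mod_cast h3
    have hDK : (D : ℝ) * K p * 16 ≤ ε * L := by
      rw [div_le_iff₀ hε] at hX2
      calc (D : ℝ) * K p * 16 ≤ X * X * 16 := by gcongr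
        _ = X ^ 2 * 32 / 2 := by ring
        _ ≤ X ^ 2 * (X ^ 2 * ε) / 2 := by gcongr
        _ = ε * (X ^ 4 / 2) := by ring
        _ ≤ ε * L := by gcongr
    have hNε : 32 ≤ ε * N := by
      rw [div_lt_iff₀ hε] at hN; linarith
    rw [div_le_iff₀ hp0]
    refine le_of_mul_le_mul_right (h3'.trans ?_) (mul_pos hN0 hL')
    have h6 : 32 * L ≤ ε * N * L := by gcongr
    have h7 : N * (D * K p * 16) ≤ N * (ε * L) := by gcongr
    calc 8 * ((p : ℕ) : ℝ) * (2 * L + N * (D * K p))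
        = (p : ℕ) * ((32 * L + N * (D * K p * 16)) / 2) := by ring
      _ ≤ (p : ℕ) * ((ε * N * L + N * (ε * L)) / 2) := by gcongr
      _ = _ := by ring

/-- If `K = o(log p)` then almost invariant sets exist. -/
theorem exists_isAlmostAffineInvariant {K : Nat.Primes → ℕ}
    (hK : (fun p : Nat.Primes => (K p : ℝ)) =o[primesAtTop]
      fun p : Nat.Primes => Real.log (p : ℕ)) :
    ∃ A : (p : Nat.Primes) → Finset (ZMod p), IsAlmostAffineInvariant K A := by
  -- Choosing a minimiser of the error for each p gives one family that serves every ε, with no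
  -- diagonal argument.
  have hmin : ∀ p : Nat.Primes, ∃ A : Finset (ZMod p), ∀ B : Finset (ZMod p),
      invarianceError p (K p) A ≤ invarianceError p (K p) B := fun p => by
    have : NeZero (p : ℕ) := ⟨p.2.ne_zero⟩
    exact Finite.exists_min _
  choose A hA using hmin
  have herr : ∀ ε > 0, ∀ᶠ p : Nat.Primes in primesAtTop, invarianceError p (K p) (A p) ≤ ε :=
    fun ε hε => (eventually_exists_invarianceError_le hK hε).mono
      fun p ⟨B, hB⟩ => (hA p B).trans hB
  refine ⟨A, ?_, ?_⟩
  · rw [Metric.tendsto_nhds]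
    intro ε hε
    filter_upwards [herr (ε / 2) (by positivity)] with p hp
    rw [Real.dist_eq]
    exact ((le_max_left _ _).trans hp).trans_lt (by linarith)
  · rw [Metric.tendsto_nhds]
    intro ε hε
    filter_upwards [herr (ε / 2) (by positivity)] with p hp
    rw [Real.dist_eq, sub_zero, abs_of_nonneg (by positivity)]
    exact ((le_max_right _ _).trans hp).trans_lt (by linarith)

theorem theorem1p1 (K : Nat.Primes → ℕ) (hK : ∀ p, 1 ≤ K p) :
    (∃ A : (p : Nat.Primes) → Finset (ZMod p), IsAlmostAffineInvariant K A) ↔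
      (fun p : Nat.Primes => (K p : ℝ)) =o[primesAtTop] fun p : Nat.Primes => Real.log (p : ℕ) :=
  ⟨fun ⟨_, hA⟩ => isLittleO_of_isAlmostAffineInvariant hA, exists_isAlmostAffineInvariant⟩
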